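/- Let $r\ge 2$ be an integer and $p\ge 1$ a real number. For an $r$-uniform hypergraph $H$ on a finite nonempty vertex set $V$, with edge set $E(H)$, let $$\rho_p(H)=\max\Big\{\, r\sum_{e\in E(H)}\ \prod_{i\in e}x_i \;:\; x\in\mathbb{R}^V,\ x_i\ge 0 \text{ for all } i\in V,\ \Big(\sum_{i\in V}|x_i|^p\Big)^{1/p}=1\Big\}$$ be its $p$-spectral radius. For real $s$ write $\binom{s}{r}=\frac{s(s-1)\cdots(s-r+1)}{r!}$. Suppose that $H$ has $m=\binom{s}{r}$ edges, where $s\ge r-1$ is real. Then $$\rho_p(H)\le \frac{rm}{s^{r/p}}.$$ Moreover, if $|V|\ge r-1$ (which is automatic when $m\ge 1$), equality holds if and only if $s$ is an integer and $H$ is the complete $r$-uniform hypergraph $K_s^r$ on $s$ vertices, possibly with some isolated vertices added (that is, there is a set of $s$ vertices whose $r$-element subsets are exactly the edges of $H$). -/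

import Mathlib

/-! An `r`-uniform hypergraph on a finite vertex set `V` is given by its edge set
`H : Finset (Finset V)`, all of whose members have cardinality `r` (`Set.Sized r`). Vertices lying
in no member of `H` are the isolated vertices. For real `s`, the binomial coefficient is
`Ring.choose s r`. -/

/-- For real `s`, `Ring.choose s r` is the polynomial `s (s - 1) ⋯ (s - r + 1) / r!`. -/
theorem Real.ringChoose_eq_prod_div (s : ℝ) (r : ℕ) :
    Ring.choose s r = (∏ i ∈ Finset.range r, (s - i)) / (Nat.factorial r : ℝ) := by
  rw [Ring.choose_eq_smul, smul_eq_mul, inv_mul_eq_div, ← Polynomial.aeval_eq_smeval,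
    Polynomial.aeval_def, Polynomial.eval₂_eq_eval_map, descPochhammer_map,
    descPochhammer_eval_eq_prod_range]

namespace UniformHypergraph

variable {V : Type*}

/-- The polynomial form `P_H(x) = r ∑_{e ∈ E(H)} ∏_{i ∈ e} x_i`. -/
def polyForm (r : ℕ) (H : Finset (Finset V)) (x : V → ℝ) : ℝ :=
  r * ∑ e ∈ H, ∏ i ∈ e, x i

/-- The `p`-norm `(∑ i, |x i| ^ p) ^ (1 / p)` of a real vector. -/
noncomputable def pNorm [Fintype V] (p : ℝ) (x : V → ℝ) : ℝ :=
  (∑ i, |x i| ^ p) ^ (1 / p)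

/-- The set of nonnegative vectors of `p`-norm one. -/
def nonnegSphere (V : Type*) [Fintype V] (p : ℝ) : Set (V → ℝ) :=
  {x | (∀ i, 0 ≤ x i) ∧ pNorm p x = 1}

/-- The `p`-spectral radius: the maximum of the polynomial form over the nonnegative vectors of
`p`-norm one. -/
noncomputable def pSpectralRadius [Fintype V] (p : ℝ) (r : ℕ) (H : Finset (Finset V)) : ℝ :=
  sSup (polyForm r H '' nonnegSphere V p)

/-- The supremum in `pSpectralRadius` is a maximum. -/
theorem isGreatest_pSpectralRadius [Fintype V] [Nonempty V] {p : ℝ} (hp : 1 ≤ p) (r : ℕ)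
    (H : Finset (Finset V)) :
    IsGreatest (polyForm r H '' nonnegSphere V p) (pSpectralRadius p r H) := by
  classical
  have hp0 : 0 < p := by linarith
  have hcont : Continuous (polyForm r H) := by
    unfold polyForm
    fun_prop
  have hncont : Continuous (fun x : V → ℝ => pNorm p x) := by
    unfold pNorm
    refine Continuous.rpow_const ?_ (fun x => Or.inr (by positivity))
    refine continuous_finsetSum _ (fun i _ => ?_)
    exact Continuous.rpow_const (by fun_prop) (fun x => Or.inr hp0.le)
  have hclosed : IsClosed (nonnegSphere V p) := by
    have h1 : IsClosed {x : V → ℝ | ∀ i, 0 ≤ x i} := by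
      simp only [Set.ofPred_forall]
      exact isClosed_iInter (fun i => isClosed_le continuous_const (continuous_apply i))
    exact h1.inter (isClosed_eq hncont continuous_const)
  have hsub : nonnegSphere V p ⊆ Set.Icc (fun _ => 0) (fun _ => 1) := by
    rintro x ⟨hx0, hx1⟩
    refine ⟨fun i => hx0 i, fun i => ?_⟩
    have hsum0 : 0 ≤ ∑ i, |x i| ^ p := Finset.sum_nonneg (fun i _ => by positivity)
    have hsum : ∑ i, |x i| ^ p = 1 := by
      unfold pNorm at hx1
      rwa [one_div, Real.rpow_inv_eq hsum0 zero_le_one hp0.ne', Real.one_rpow] at hx1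
    have hi : |x i| ^ p ≤ 1 := by
      rw [← hsum]
      exact Finset.single_le_sum (f := fun i => |x i| ^ p) (fun i _ => by positivity)
        (Finset.mem_univ i)
    by_contra hlt
    have hlt' : 1 < |x i| := lt_of_lt_of_le (not_le.mp hlt) (le_abs_self _)
    exact absurd hi (not_le.mpr (Real.one_lt_rpow hlt' hp0))
  have hcpt : IsCompact (nonnegSphere V p) := isCompact_Icc.of_isClosed_subset hclosed hsub
  have hne : (nonnegSphere V p).Nonempty := by
    obtain ⟨v⟩ := (inferInstance : Nonempty V)
    refine ⟨fun i => if i = v then 1 else 0, fun i => by positivity, ?_⟩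
    have : ∀ i, |(if i = v then (1 : ℝ) else 0)| ^ p = if i = v then 1 else 0 := by
      intro i
      split_ifs <;> simp [hp0.ne']
    simp [pNorm, this]
  exact (hcpt.image hcont).isGreatest_sSup (hne.image _)

/-- `H` is the complete `r`-uniform hypergraph `K_n^r`, possibly with isolated vertices added: the
edges are exactly the `r`-element subsets of some set of `n` vertices. -/
def IsCompleteWithIsolated (r : ℕ) (H : Finset (Finset V)) (n : ℕ) : Prop :=
  ∃ S : Finset V, S.card = n ∧ H = S.powersetCard r

end UniformHypergraph

/-! ### Gibbs' inequality and its equality case. -/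

open Finset Real

/-! The case `p = 1` is proved by entropy. Given weights `y` of sum one with `Λ = ∑ e, ∏ v ∈ e, y v
> 0`, draw an edge with probability proportional to `∏ v ∈ e, y v` and order its vertices uniformly.
Let `u i` be the exponential of the conditional entropy of the next vertex after the first `i`.

Three facts carry the bound. Mixing the next two vertices and using subadditivity of entropy gives
`u (i + 1) + 1 ≤ u i` (`exp_seqEntropy_gap`). Gibbs' inequality against `y` gives `Λ * r! * u 0 ^ r
≤ ∏ u i` (`log_sum_prod_le`). Since the edge has at most `m` values, `∏ u i ≤ r! * m = ∏ (s - i)`.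
If `u 0 ≥ s`, the last two give `Λ ≤ m / s ^ r`; if `u 0 < s`, the descent does (`prod_descent_lt`).
Equality forces `u 0 = s`, `u 1 = s - 1` and a first vertex uniform on its support, which then has
`s` elements and contains every edge.

The power mean inequality over the `m` edges, with `y = x ^ p`, reduces general `p` to this case. -/

/-- Pointwise form of Gibbs' inequality. -/
theorem Real.negMulLog_le_of_pos {a b : ℝ} (ha : 0 ≤ a) (hb : 0 ≤ b) (h : b = 0 → a = 0) :
    negMulLog a ≤ -(a * log b) + b - a := by
  rcases ha.eq_or_lt with rfl | ha
  · simpa using hb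
  have hb' : 0 < b := hb.lt_of_ne fun h0 => ha.ne' (h h0.symm)
  have h1 := Real.log_le_sub_one_of_pos (div_pos hb' ha)
  rw [Real.log_div hb'.ne' ha.ne'] at h1
  have h2 := mul_le_mul_of_nonneg_left h1 ha.le
  have h3 : a * (b / a - 1) = b - a := by field_simp
  rw [negMulLog]
  linarith

theorem Real.eq_of_negMulLog_eq {a b : ℝ} (ha : 0 ≤ a) (hb : 0 ≤ b) (h : b = 0 → a = 0)
    (heq : negMulLog a = -(a * log b) + b - a) : a = b := by
  rcases ha.eq_or_lt with rfl | ha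
  · simpa using heq
  have hb' : 0 < b := hb.lt_of_ne fun h0 => ha.ne' (h h0.symm)
  by_contra hne
  have h1 := Real.log_lt_sub_one_of_pos (div_pos hb' ha)
    (fun h1 => hne ((div_eq_one_iff_eq ha.ne').1 h1).symm)
  rw [Real.log_div hb'.ne' ha.ne'] at h1
  have h2 := mul_lt_mul_of_pos_left h1 ha
  have h3 : a * (b / a - 1) = b - a := by field_simp
  rw [negMulLog] at heq
  linarith

namespace UniformHypergraph

variable {ι : Type*}

/-- Gibbs' inequality for finite families with equal sums. -/
theorem sum_negMulLog_le (s : Finset ι) (f g : ι → ℝ) (hf : ∀ i ∈ s, 0 ≤ f i)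
    (hg : ∀ i ∈ s, 0 ≤ g i) (h : ∀ i ∈ s, g i = 0 → f i = 0)
    (hsum : ∑ i ∈ s, g i ≤ ∑ i ∈ s, f i) :
    ∑ i ∈ s, negMulLog (f i) ≤ -∑ i ∈ s, f i * log (g i) := by
  have := Finset.sum_le_sum fun i hi => negMulLog_le_of_pos (hf i hi) (hg i hi) (h i hi)
  rw [Finset.sum_sub_distrib, Finset.sum_add_distrib, Finset.sum_neg_distrib] at this
  linarith

/-- The linear terms `g i - f i` have sum at most zero, so equality leaves no slack in any pointwise
inequality. -/
theorem eq_of_sum_negMulLog_eq (s : Finset ι) (f g : ι → ℝ) (hf : ∀ i ∈ s, 0 ≤ f i)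
    (hg : ∀ i ∈ s, 0 ≤ g i) (h : ∀ i ∈ s, g i = 0 → f i = 0)
    (hsum : ∑ i ∈ s, g i ≤ ∑ i ∈ s, f i)
    (heq : ∑ i ∈ s, negMulLog (f i) = -∑ i ∈ s, f i * log (g i)) : ∀ i ∈ s, f i = g i := by
  have hle := fun i (hi : i ∈ s) => negMulLog_le_of_pos (hf i hi) (hg i hi) (h i hi)
  have hsum' : ∑ i ∈ s, negMulLog (f i) = ∑ i ∈ s, (-(f i * log (g i)) + g i - f i) := by
    refine le_antisymm (Finset.sum_le_sum hle) ?_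
    rw [Finset.sum_sub_distrib, Finset.sum_add_distrib, Finset.sum_neg_distrib]
    linarith
  intro i hi
  exact eq_of_negMulLog_eq (hf i hi) (hg i hi) (h i hi) ((Finset.sum_eq_sum_iff_of_le hle).1 hsum' i hi)

/-- The entropy of a finite law is at most the logarithm of the size of its support. -/
theorem sum_negMulLog_le_log_card {H : Finset ι} {w : ι → ℝ} (hw : ∀ e ∈ H, 0 ≤ w e) (h1 : ∑ e ∈ H, w e = 1) :
    ∑ e ∈ H, negMulLog (w e) ≤ log (H.filter fun e => w e ≠ 0).card := by
  set S := H.filter fun e => w e ≠ 0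
  have hS : ∑ e ∈ S, w e = 1 := by rw [← h1]; exact sum_filter_ne_zero H
  have hSne : S.Nonempty := by
    by_contra h
    rw [not_nonempty_iff_eq_empty.1 h] at hS
    simp at hS
  have hc : (0 : ℝ) < S.card := by exact_mod_cast hSne.card_pos
  have hsum : ∑ e ∈ H, negMulLog (w e) = ∑ e ∈ S, negMulLog (w e) :=
    (Finset.sum_subset (filter_subset _ _) fun e he hne => by
      have : w e = 0 := by simpa [S, he] using hne
      rw [this, negMulLog_zero]).symm
  have := sum_negMulLog_le S w (fun _ => (S.card : ℝ)⁻¹)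
    (fun e he => hw e (mem_of_mem_filter e he)) (fun _ _ => by positivity)
    (fun _ _ h => absurd h (by positivity))
    (by rw [hS, sum_const, nsmul_eq_mul, mul_inv_cancel₀ hc.ne'])
  rw [← Finset.sum_mul, hS, log_inv] at this
  linarith

theorem sum_mul_div {A : Finset ι} {α : ι → ℝ} {c : ℝ} (hc : ∑ a ∈ A, α a = c) (hc0 : 0 < c) :
    ∑ x ∈ A ×ˢ A, α x.1 * α x.2 / c = c := by
  rw [← Finset.sum_div, Finset.sum_product]
  simp only
  rw [← Finset.sum_mul_sum, hc, mul_div_assoc, div_self hc0.ne', mul_one]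

/-! ### Exchangeable pairs and the mixture inequality. -/

variable [DecidableEq ι]

/-- The law of `(A, C)`, where `C` equals `A` with probability `q` and `B` otherwise,
and `(A, B)` has law `g` with marginal `α`. -/
def mixture (q : ℝ) (g : ι → ι → ℝ) (α : ι → ℝ) (x : ι × ι) : ℝ :=
  (if x.1 = x.2 then q * α x.1 else 0) + (1 - q) * g x.1 x.2

section Mixture

variable {A : Finset ι} {g : ι → ι → ℝ} {α : ι → ℝ} {c q : ℝ}

theorem sum_mixture (hα : ∀ a ∈ A, ∑ b ∈ A, g a b = α a) (f : ι → ℝ) : ∑ x ∈ A ×ˢ A, mixture q g α x * f x.1 = ∑ a ∈ A, α a * f a := by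
  rw [Finset.sum_product]
  refine Finset.sum_congr rfl fun a ha => ?_
  simp only [mixture]
  rw [← Finset.sum_mul, Finset.sum_add_distrib, Finset.sum_ite_eq, if_pos ha, ← Finset.mul_sum,
    hα a ha]
  ring

theorem mixture_swap (hsymm : ∀ a b, g a b = g b a) (x : ι × ι) :
    mixture q g α x.swap = mixture q g α x := by
  obtain ⟨a, b⟩ := x
  by_cases h : a = b
  · subst h; rfl
  · simp [mixture, h, Ne.symm h, hsymm b a]

theorem sum_mixture_snd (hsymm : ∀ a b, g a b = g b a) (hα : ∀ a ∈ A, ∑ b ∈ A, g a b = α a)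
    (f : ι → ℝ) :
    ∑ x ∈ A ×ˢ A, mixture q g α x * f x.2 = ∑ a ∈ A, α a * f a := by
  rw [← sum_mixture (q := q) hα f]
  refine Finset.sum_equiv (Equiv.prodComm ι ι) (by simp [and_comm]) fun x _ => ?_
  simp [mixture_swap hsymm]

/-- As `g` vanishes on the diagonal, the two components of the mixture have disjoint supports. The
pair thus reveals which component was chosen, and the entropy splits exactly. -/
theorem sum_negMulLog_mixture (hdiag : ∀ a, g a a = 0)
    (hα : ∀ a ∈ A, ∑ b ∈ A, g a b = α a) (hc : ∑ a ∈ A, α a = c) :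
    ∑ x ∈ A ×ˢ A, negMulLog (mixture q g α x) =
      c * (negMulLog q + negMulLog (1 - q)) + q * ∑ a ∈ A, negMulLog (α a) +
        (1 - q) * ∑ a ∈ A, ∑ b ∈ A, negMulLog (g a b) := by
  have key : ∀ a ∈ A, ∑ b ∈ A, negMulLog (mixture q g α (a, b)) =
      α a * (negMulLog q + negMulLog (1 - q)) + q * negMulLog (α a) +
        (1 - q) * ∑ b ∈ A, negMulLog (g a b) := by
    intro a ha
    have h1 : ∀ b ∈ A, negMulLog (mixture q g α (a, b)) =
        (if a = b then negMulLog (q * α a) else 0) + negMulLog ((1 - q) * g a b) := by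
      intro b _
      by_cases h : a = b
      · subst h; simp [mixture, hdiag]
      · simp [mixture, h]
    rw [Finset.sum_congr rfl h1, Finset.sum_add_distrib, Finset.sum_ite_eq, if_pos ha]
    simp only [negMulLog_mul]
    rw [Finset.sum_add_distrib, ← Finset.sum_mul, ← Finset.mul_sum, hα a ha]
    ring
  rw [Finset.sum_product, Finset.sum_congr rfl key, Finset.sum_add_distrib,
    Finset.sum_add_distrib, ← Finset.sum_mul, ← Finset.mul_sum, ← Finset.mul_sum, hc]

/-- Both marginals of the mixture are `α`, so its cross entropy against the product law does not
depend on `q`. -/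
theorem sum_mixture_log (hg : ∀ a b, 0 ≤ g a b) (hsymm : ∀ a b, g a b = g b a)
    (hα : ∀ a ∈ A, ∑ b ∈ A, g a b = α a) (hc : ∑ a ∈ A, α a = c) (hc0 : 0 < c) :
    ∑ x ∈ A ×ˢ A, mixture q g α x * log (α x.1 * α x.2 / c) =
      2 * ∑ a ∈ A, α a * log (α a) - c * log c := by
  have hα0 : ∀ a ∈ A, α a = 0 → ∀ b ∈ A, g a b = 0 := fun a ha h b hb =>
    (Finset.sum_eq_zero_iff_of_nonneg fun b _ => hg a b).1 ((hα a ha).trans h) b hb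
  have : ∀ x ∈ A ×ˢ A, mixture q g α x * log (α x.1 * α x.2 / c) =
      mixture q g α x * log (α x.1) + mixture q g α x * log (α x.2)
        - mixture q g α x * log c := by
    rintro ⟨a, b⟩ hx
    obtain ⟨ha, hb⟩ := Finset.mem_product.1 hx
    by_cases h1 : α a = 0
    · have : mixture q g α (a, b) = 0 := by simp [mixture, h1, hα0 a ha h1 b hb]
      simp [this]
    by_cases h2 : α b = 0
    · have : mixture q g α (a, b) = 0 := by
        have hne : a ≠ b := fun h => h1 (h ▸ h2)
        simp [mixture, hne, hsymm a b, hα0 b hb h2 a ha]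
      simp [this]
    dsimp only
    rw [log_div (mul_ne_zero h1 h2) hc0.ne', log_mul h1 h2]
    ring
  rw [Finset.sum_congr rfl this, Finset.sum_sub_distrib, Finset.sum_add_distrib,
    sum_mixture hα fun a => log (α a), sum_mixture_snd hsymm hα fun a => log (α a),
    sum_mixture hα fun _ => log c, ← Finset.sum_mul, hc]
  ring

theorem mixture_nonneg (hg : ∀ a b, 0 ≤ g a b) (hα0 : ∀ a ∈ A, 0 ≤ α a) (hq0 : 0 ≤ q) (hq1 : q ≤ 1)
    (x : ι × ι) (hx : x ∈ A ×ˢ A) : 0 ≤ mixture q g α x := by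
  have := mul_nonneg hq0 (hα0 x.1 (Finset.mem_product.1 hx).1)
  have := mul_nonneg (sub_nonneg.2 hq1) (hg x.1 x.2)
  unfold mixture
  split_ifs <;> linarith

theorem mixture_eq_zero (hg : ∀ a b, 0 ≤ g a b) (hsymm : ∀ a b, g a b = g b a)
    (hα : ∀ a ∈ A, ∑ b ∈ A, g a b = α a) (hc0 : 0 < c) (x : ι × ι) (hx : x ∈ A ×ˢ A)
    (h : α x.1 * α x.2 / c = 0) : mixture q g α x = 0 := by
  have hα0 : ∀ a ∈ A, α a = 0 → ∀ b ∈ A, g a b = 0 := fun a ha h b hb =>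
    (Finset.sum_eq_zero_iff_of_nonneg fun b _ => hg a b).1 ((hα a ha).trans h) b hb
  obtain ⟨a, b⟩ := x
  obtain ⟨ha, hb⟩ := Finset.mem_product.1 hx
  have h' : α a = 0 ∨ α b = 0 := by simpa [hc0.ne'] using h
  by_cases hab : a = b
  · subst hab
    have h1 : α a = 0 := by simpa using h'
    simp [mixture, h1, hα0 a ha h1 a ha]
  · rcases h' with h1 | h1
    · simp [mixture, hab, hα0 a ha h1 b hb]
    · simp [mixture, hab, hsymm a b, hα0 b hb h1 a ha]

/-- If `(A, B)` is exchangeable with `A ≠ B`, then `H(A) ≥ h(q) + (1 - q) H(B | A)`, written for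
laws of total mass `c`. -/
theorem entropy_pair_le (hg : ∀ a b, 0 ≤ g a b) (hsymm : ∀ a b, g a b = g b a)
    (hdiag : ∀ a, g a a = 0) (hα : ∀ a ∈ A, ∑ b ∈ A, g a b = α a)
    (hc : ∑ a ∈ A, α a = c) (hq0 : 0 ≤ q) (hq1 : q ≤ 1) :
    c * (negMulLog q + negMulLog (1 - q)) + (1 - q) *
        ((∑ a ∈ A, ∑ b ∈ A, negMulLog (g a b)) - ∑ a ∈ A, negMulLog (α a)) ≤
      (∑ a ∈ A, negMulLog (α a)) - negMulLog c := by
  have hα0 : ∀ a ∈ A, 0 ≤ α a := fun a ha => hα a ha ▸ Finset.sum_nonneg fun b _ => hg a b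
  rcases (hc ▸ Finset.sum_nonneg hα0 : 0 ≤ c).eq_or_lt with h0 | hc0
  · have hαz : ∀ a ∈ A, α a = 0 := (Finset.sum_eq_zero_iff_of_nonneg hα0).1 (hc.trans h0.symm)
    have hgz : ∀ a ∈ A, ∀ b ∈ A, g a b = 0 := fun a ha =>
      (Finset.sum_eq_zero_iff_of_nonneg fun b _ => hg a b).1 ((hα a ha).trans (hαz a ha))
    have h1 : ∑ a ∈ A, negMulLog (α a) = 0 :=
      Finset.sum_eq_zero fun a ha => by rw [hαz a ha, negMulLog_zero]
    have h2 : ∑ a ∈ A, ∑ b ∈ A, negMulLog (g a b) = 0 :=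
      Finset.sum_eq_zero fun a ha => Finset.sum_eq_zero fun b hb => by
        rw [hgz a ha b hb, negMulLog_zero]
    rw [h1, h2, ← h0]
    simp
  -- Subadditivity `H(A, C) ≤ H(A) + H(C) = 2 H(A)`, as Gibbs' inequality against the product of the
  -- marginals.
  have h := sum_negMulLog_le (A ×ˢ A) (mixture q g α) (fun x => α x.1 * α x.2 / c)
    (mixture_nonneg hg hα0 hq0 hq1)
    (fun x hx => div_nonneg (mul_nonneg (hα0 _ (Finset.mem_product.1 hx).1)
      (hα0 _ (Finset.mem_product.1 hx).2)) hc0.le)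
    (mixture_eq_zero hg hsymm hα hc0)
    (by
      have := sum_mixture (q := q) hα fun _ => 1
      simp only [mul_one] at this
      rw [sum_mul_div hc hc0, this, hc])
  rw [sum_mixture_log hg hsymm hα hc hc0, sum_negMulLog_mixture hdiag hα hc] at h
  have hneg : ∑ a ∈ A, negMulLog (α a) = -∑ a ∈ A, α a * log (α a) := by
    simp [negMulLog, Finset.sum_neg_distrib]
  have hcneg : negMulLog c = -(c * log c) := by simp [negMulLog]
  linarith

/-- Equality makes `A` and `C` independent; on the diagonal this reads `q * α a = α a * α a / c`. -/
theorem eq_of_entropy_pair_eq (hg : ∀ a b, 0 ≤ g a b) (hsymm : ∀ a b, g a b = g b a)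
    (hdiag : ∀ a, g a a = 0) (hα : ∀ a ∈ A, ∑ b ∈ A, g a b = α a)
    (hc : ∑ a ∈ A, α a = c) (hc0 : 0 < c) (hq0 : 0 ≤ q) (hq1 : q ≤ 1)
    (heq : c * (negMulLog q + negMulLog (1 - q)) + (1 - q) *
        ((∑ a ∈ A, ∑ b ∈ A, negMulLog (g a b)) - ∑ a ∈ A, negMulLog (α a)) =
      (∑ a ∈ A, negMulLog (α a)) - negMulLog c) (a : ι) (ha : a ∈ A) (hne : α a ≠ 0) :
    α a = q * c := by
  have hα0 : ∀ a ∈ A, 0 ≤ α a := fun a ha => hα a ha ▸ Finset.sum_nonneg fun b _ => hg a b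
  have h := eq_of_sum_negMulLog_eq (A ×ˢ A) (mixture q g α) (fun x => α x.1 * α x.2 / c)
    (mixture_nonneg hg hα0 hq0 hq1)
    (fun x hx => div_nonneg (mul_nonneg (hα0 _ (Finset.mem_product.1 hx).1)
      (hα0 _ (Finset.mem_product.1 hx).2)) hc0.le)
    (mixture_eq_zero hg hsymm hα hc0)
    (by
      have := sum_mixture (q := q) hα fun _ => 1
      simp only [mul_one] at this
      rw [sum_mul_div hc hc0, this, hc])
    (by
      rw [sum_mixture_log hg hsymm hα hc hc0, sum_negMulLog_mixture hdiag hα hc]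
      have hneg : ∑ a ∈ A, negMulLog (α a) = -∑ a ∈ A, α a * log (α a) := by
        simp [negMulLog, Finset.sum_neg_distrib]
      have hcneg : negMulLog c = -(c * log c) := by simp [negMulLog]
      linarith) (a, a) (Finset.mk_mem_product ha ha)
  simp only [mixture, if_true, hdiag, mul_zero, add_zero] at h
  field_simp at h
  linarith

end Mixture

/-! ### Entropies of exchangeable sequences of distinct vertices. -/

section Marginals

/-- The law of two further vertices after the set `T`. -/
def pairLaw (P : Finset ι → ℝ) (T : Finset ι) (a b : ι) : ℝ :=
  if a = b then 0 else P (insert b (insert a T))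

theorem pairLaw_symm {P : Finset ι → ℝ} (T : Finset ι) (a b : ι) : pairLaw P T a b = pairLaw P T b a := by
  by_cases h : a = b
  · subst h; rfl
  · simp [pairLaw, h, Ne.symm h, Finset.insert_comm a b]

variable [Fintype ι]

/-- Every set of size `k + 1` arises from `k + 1` pairs of a `k`-set and a vertex outside it. -/
theorem sum_powersetCard_sum_insert (k : ℕ) (G : Finset ι → ℝ) :
    ∑ T ∈ powersetCard k univ, ∑ v ∈ Tᶜ, G (insert v T) =
      (k + 1) * ∑ S ∈ powersetCard (k + 1) univ, G S := by
  have h : ∑ S ∈ powersetCard (k + 1) (univ : Finset ι), ∑ _v ∈ S, G S =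
      (k + 1) * ∑ S ∈ powersetCard (k + 1) univ, G S := by
    rw [Finset.mul_sum]
    refine Finset.sum_congr rfl fun S hS => ?_
    rw [Finset.sum_const, (Finset.mem_powersetCard.1 hS).2, nsmul_eq_mul]
    push_cast
    ring
  rw [← h, Finset.sum_sigma', Finset.sum_sigma']
  refine Finset.sum_bij' (fun x _ => ⟨insert x.2 x.1, x.2⟩) (fun x _ => ⟨x.1.erase x.2, x.2⟩)
    ?_ ?_ ?_ ?_ ?_
  · rintro ⟨T, v⟩ hx
    simp only [mem_sigma, mem_powersetCard, mem_compl, subset_univ, true_and] at hx ⊢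
    exact ⟨by rw [card_insert_of_notMem hx.2, hx.1], mem_insert_self _ _⟩
  · rintro ⟨S, v⟩ hx
    simp only [mem_sigma, mem_powersetCard, mem_compl, subset_univ, true_and] at hx ⊢
    exact ⟨by rw [card_erase_of_mem hx.2, hx.1, Nat.add_sub_cancel], notMem_erase _ _⟩
  · rintro ⟨T, v⟩ hx
    simp only [mem_sigma, mem_powersetCard, mem_compl, subset_univ, true_and] at hx ⊢
    rw [erase_insert hx.2]
  · rintro ⟨S, v⟩ hx
    simp only [mem_sigma, mem_powersetCard, subset_univ, true_and] at hx ⊢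
    rw [insert_erase hx.2]
  · intro x _
    rfl

/-- The entropy of an exchangeable sequence of `k` distinct vertices, where `P T` is the
probability that it is a given ordering of `T`. -/
noncomputable def seqEntropy (P : Finset ι → ℝ) (k : ℕ) : ℝ :=
  k.factorial * ∑ T ∈ powersetCard k univ, negMulLog (P T)

variable {r : ℕ} {P : Finset ι → ℝ}

theorem seqEntropy_succ_sub (k : ℕ) :
    seqEntropy P (k + 1) - seqEntropy P k = k.factorial * ∑ T ∈ powersetCard k univ,
      ((∑ v ∈ Tᶜ, negMulLog (P (insert v T))) - negMulLog (P T)) := by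
  rw [Finset.sum_sub_distrib, sum_powersetCard_sum_insert k fun S => negMulLog (P S), seqEntropy,
    seqEntropy, Nat.factorial_succ]
  push_cast
  ring

/-- Grouping by the first `k` vertices, rather than `k + 1`, makes this increment comparable with
the preceding one for each fixed `T`. -/
theorem seqEntropy_succ_succ_sub (k : ℕ) :
    seqEntropy P (k + 2) - seqEntropy P (k + 1) = k.factorial * ∑ T ∈ powersetCard k univ,
      ∑ a ∈ Tᶜ, ((∑ b ∈ (insert a T)ᶜ, negMulLog (P (insert b (insert a T))))
        - negMulLog (P (insert a T))) := by
  rw [seqEntropy_succ_sub, sum_powersetCard_sum_insert k fun S =>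
    (∑ b ∈ Sᶜ, negMulLog (P (insert b S))) - negMulLog (P S), Nat.factorial_succ]
  push_cast
  ring

theorem factorial_mul_sum_eq_one (hP : ∀ T, T.card < r → ∑ v ∈ Tᶜ, P (insert v T) = P T)
    (h1 : P ∅ = 1) (k : ℕ) (hk : k ≤ r) :
    k.factorial * ∑ T ∈ powersetCard k univ, P T = 1 := by
  induction k with
  | zero => simp [h1]
  | succ k ih =>
    rw [← ih (by omega), Nat.factorial_succ]
    have : ∑ T ∈ powersetCard k univ, P T = (k + 1) * ∑ S ∈ powersetCard (k + 1) univ, P S := by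
      rw [← sum_powersetCard_sum_insert]
      refine Finset.sum_congr rfl fun T hT => (hP T ?_).symm
      rw [(mem_powersetCard.1 hT).2]
      omega
    rw [this]
    push_cast
    ring

theorem sum_compl_insert (T : Finset ι) (a : ι) (F : ℝ → ℝ) (hF : F 0 = 0) (ha : a ∈ Tᶜ) :
    ∑ b ∈ (insert a T)ᶜ, F (P (insert b (insert a T))) = ∑ b ∈ Tᶜ, F (pairLaw P T a b) := by
  rw [compl_insert, ← Finset.add_sum_erase _ _ ha]
  have : F (pairLaw P T a a) = 0 := by simp [pairLaw, hF]
  rw [this, zero_add]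
  refine Finset.sum_congr rfl fun b hb => ?_
  rw [pairLaw, if_neg (ne_of_mem_erase hb).symm]

/-- This is `entropy_pair_le` for the next two vertices given the initial segment `T`, with mass `c
= P T`, summed over all `T`. -/
theorem seqEntropy_gap (hP0 : ∀ T, 0 ≤ P T)
    (hP : ∀ T, T.card < r → ∑ v ∈ Tᶜ, P (insert v T) = P T) (h1 : P ∅ = 1) (k : ℕ)
    (hk : k + 2 ≤ r) {q : ℝ} (hq0 : 0 ≤ q) (hq1 : q ≤ 1) :
    negMulLog q + negMulLog (1 - q) + (1 - q) * (seqEntropy P (k + 2) - seqEntropy P (k + 1)) ≤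
      seqEntropy P (k + 1) - seqEntropy P k := by
  have hone := factorial_mul_sum_eq_one hP h1 k (by omega)
  have key : ∀ T ∈ powersetCard k (univ : Finset ι),
      P T * (negMulLog q + negMulLog (1 - q)) + (1 - q) *
        ∑ a ∈ Tᶜ, ((∑ b ∈ (insert a T)ᶜ, negMulLog (P (insert b (insert a T))))
          - negMulLog (P (insert a T))) ≤
      (∑ v ∈ Tᶜ, negMulLog (P (insert v T))) - negMulLog (P T) := by
    intro T hT
    have hT' := (mem_powersetCard.1 hT).2
    have := entropy_pair_le (A := Tᶜ) (g := pairLaw P T) (α := fun a => P (insert a T))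
      (c := P T) (q := q) (fun a b => by unfold pairLaw; split_ifs <;> simp [hP0])
      (pairLaw_symm T) (fun a => by simp [pairLaw])
      (fun a ha => by
        rw [← sum_compl_insert T a (fun x => x) rfl ha, hP]
        rw [card_insert_of_notMem (by simpa using ha)]
        omega)
      (hP T (by omega)) hq0 hq1
    rw [Finset.sum_sub_distrib]
    rwa [Finset.sum_congr rfl fun a ha => sum_compl_insert T a negMulLog negMulLog_zero ha]
  have hsum := mul_le_mul_of_nonneg_left (Finset.sum_le_sum key)
    (Nat.cast_nonneg (α := ℝ) k.factorial)
  rw [Finset.sum_add_distrib, ← Finset.sum_mul, ← Finset.mul_sum, mul_add, ← mul_assoc, hone,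
    one_mul, mul_left_comm, ← seqEntropy_succ_succ_sub, ← seqEntropy_succ_sub] at hsum
  exact hsum

/-- At level zero the only initial segment is `∅`, so the equality case of the pair inequality
applies directly. -/
theorem singleton_eq_of_seqEntropy_eq (hP0 : ∀ T, 0 ≤ P T)
    (hP : ∀ T, T.card < r → ∑ v ∈ Tᶜ, P (insert v T) = P T) (h1 : P ∅ = 1) (hr : 2 ≤ r)
    {q : ℝ} (hq0 : 0 ≤ q) (hq1 : q ≤ 1)
    (heq : negMulLog q + negMulLog (1 - q) + (1 - q) * (seqEntropy P 2 - seqEntropy P 1) =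
      seqEntropy P 1 - seqEntropy P 0) (a : ι) (ha : P {a} ≠ 0) : P {a} = q := by
  have := eq_of_entropy_pair_eq (A := (∅ : Finset ι)ᶜ) (g := pairLaw P ∅)
      (α := fun a => P (insert a ∅))
      (c := P ∅) (q := q) (fun a b => by unfold pairLaw; split_ifs <;> simp [hP0])
      (pairLaw_symm ∅) (fun a => by simp [pairLaw])
      (fun a ha => by
        rw [← sum_compl_insert ∅ a (fun x => x) rfl ha, hP]
        rw [card_insert_of_notMem (by simp)]
        simp
        omega)
      (hP ∅ (by simp; omega)) (by simp [h1]) hq0 hq1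
      (by
        rw [seqEntropy_succ_succ_sub 0, seqEntropy_succ_sub 0,
          powersetCard_zero, sum_singleton, sum_singleton, Finset.sum_sub_distrib,
          Finset.sum_congr rfl
            fun a ha => sum_compl_insert ∅ a negMulLog negMulLog_zero ha] at heq
        simpa [h1] using heq)
      a (by simp) (by simpa using ha)
  simpa [h1] using this

/-- For an exchangeable sequence of `r` distinct vertices, the exponentials of the successive
conditional entropies drop by at least one in each step. -/
theorem exp_seqEntropy_gap (hP0 : ∀ T, 0 ≤ P T)
    (hP : ∀ T, T.card < r → ∑ v ∈ Tᶜ, P (insert v T) = P T) (h1 : P ∅ = 1) (k : ℕ)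
    (hk : k + 2 ≤ r) :
    exp (seqEntropy P (k + 2) - seqEntropy P (k + 1)) + 1 ≤
      exp (seqEntropy P (k + 1) - seqEntropy P k) := by
  set D := seqEntropy P (k + 2) - seqEntropy P (k + 1)
  have hu := exp_pos D
  have hu1 : 0 < exp D + 1 := by linarith
  have hq : (1 : ℝ) - 1 / (exp D + 1) = exp D / (exp D + 1) := by field_simp; ring
  -- This `q` maximizes `negMulLog q + negMulLog (1 - q) + (1 - q) * D`; the maximum is `log (exp D
  -- + 1)`.
  have h := seqEntropy_gap hP0 hP h1 k hk (q := 1 / (exp D + 1)) (by positivity)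
    (by rw [div_le_one hu1]; linarith)
  rw [← Real.log_le_iff_le_exp hu1]
  refine le_trans (le_of_eq ?_) h
  rw [hq, negMulLog, negMulLog, log_div one_ne_zero hu1.ne', log_div hu.ne' hu1.ne', log_exp,
    log_one]
  field_simp
  ring

end Marginals

end UniformHypergraph

/-! ### The randomly ordered random edge. -/

namespace UniformHypergraph

variable {V : Type*} [DecidableEq V] {r : ℕ} {H : Finset (Finset V)} {w : Finset V → ℝ}

/-- If an edge is drawn with law `w` and its vertices are ordered uniformly, this is the probability
that a given ordering of `T` is an initial segment. -/
noncomputable def marginal (r : ℕ) (H : Finset (Finset V)) (w : Finset V → ℝ) (T : Finset V) : ℝ :=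
  (r - T.card).factorial / r.factorial * ∑ e ∈ H with T ⊆ e, w e

theorem marginal_nonneg (hw : ∀ e ∈ H, 0 ≤ w e) (T : Finset V) : 0 ≤ marginal r H w T :=
  mul_nonneg (by positivity) (Finset.sum_nonneg fun e he => hw e (mem_of_mem_filter e he))

theorem marginal_empty : marginal r H w ∅ = ∑ e ∈ H, w e := by
  have : (r.factorial : ℝ) ≠ 0 := by positivity
  simp [marginal, this]

theorem marginal_singleton (hr : 1 ≤ r) (v : V) :
    marginal r H w {v} = (∑ e ∈ H with v ∈ e, w e) / r := by
  obtain ⟨k, rfl⟩ := Nat.exists_eq_add_of_le' hr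
  have h1 : (k.factorial : ℝ) ≠ 0 := by positivity
  have h2 : ((k : ℝ) + 1) ≠ 0 := by positivity
  simp only [marginal, card_singleton, Nat.add_sub_cancel, singleton_subset_iff,
    Nat.factorial_succ]
  push_cast
  field_simp

theorem marginal_of_mem (hH : (H : Set (Finset V)).Sized r) {T : Finset V} (hT : T ∈ H) :
    marginal r H w T = w T / r.factorial := by
  have : (H.filter fun e => T ⊆ e) = {T} := by
    ext e
    simp only [mem_filter, mem_singleton]
    refine ⟨fun h => (eq_of_subset_of_card_le h.2 ?_).symm, by rintro rfl; exact ⟨hT, Subset.rfl⟩⟩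
    rw [hH h.1, hH hT]
  rw [marginal, this, sum_singleton, hH hT]
  simp
  ring

theorem marginal_of_notMem (hH : (H : Set (Finset V)).Sized r) {T : Finset V}
    (hT : T.card = r) (h : T ∉ H) : marginal r H w T = 0 := by
  have : (H.filter fun e => T ⊆ e) = ∅ := by
    refine filter_eq_empty_iff.2 fun e he hTe => h ?_
    rwa [eq_of_subset_of_card_le hTe (by rw [hH he, hT])]
  rw [marginal, this, sum_empty, mul_zero]

variable [Fintype V]

/-- An edge containing `T` offers `r - T.card` choices of the next vertex, which is the ratio of the
two factorial weights. -/
theorem sum_marginal_insert (hH : (H : Set (Finset V)).Sized r) {T : Finset V} (hT : T.card < r) :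
    ∑ v ∈ Tᶜ, marginal r H w (insert v T) = marginal r H w T := by
  obtain ⟨k, hk⟩ : ∃ k, r - T.card = k + 1 := ⟨r - T.card - 1, by omega⟩
  have h1 : ∀ v ∈ Tᶜ, marginal r H w (insert v T) =
      k.factorial / r.factorial * ∑ e ∈ H with T ⊆ e, if v ∈ e then w e else 0 := by
    intro v hv
    rw [marginal, card_insert_of_notMem (by simpa using hv), show r - (T.card + 1) = k by omega,
      ← sum_filter, filter_filter]
    simp only [insert_subset_iff, and_comm]
  rw [Finset.sum_congr rfl h1, ← Finset.mul_sum, Finset.sum_comm, marginal, hk,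
    Nat.factorial_succ]
  have h2 : ∀ e ∈ H.filter fun e => T ⊆ e, ∑ v ∈ Tᶜ, (if v ∈ e then w e else 0) =
      (k + 1) * w e := by
    intro e he
    obtain ⟨he, hTe⟩ := mem_filter.1 he
    have : (Tᶜ.filter fun v => v ∈ e) = e \ T := by
      ext v; simp [and_comm]
    rw [← sum_filter, this, sum_const, card_sdiff_of_subset hTe, hH he, hk, nsmul_eq_mul]
    push_cast
    ring
  rw [Finset.sum_congr rfl h2, ← Finset.mul_sum]
  push_cast
  ring

theorem sum_marginal_singleton_mul (hr : 1 ≤ r) (f : V → ℝ) :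
    r * ∑ v, marginal r H w {v} * f v = ∑ e ∈ H, w e * ∑ v ∈ e, f v := by
  have hr' : (r : ℝ) ≠ 0 := by positivity
  have h1 : ∀ v ∈ (univ : Finset V), marginal r H w {v} * f v =
      (∑ e ∈ H, if v ∈ e then w e * f v else 0) / r := by
    intro v _
    rw [marginal_singleton hr, ← sum_filter, ← sum_mul]
    ring
  rw [Finset.sum_congr rfl h1, ← Finset.sum_div, mul_div_cancel₀ _ hr', Finset.sum_comm]
  refine Finset.sum_congr rfl fun e _ => ?_
  rw [Finset.mul_sum, ← sum_filter]
  simp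

theorem seqEntropy_marginal_zero (h1 : ∑ e ∈ H, w e = 1) : seqEntropy (marginal r H w) 0 = 0 := by
  simp [seqEntropy, marginal_empty, h1]

theorem seqEntropy_marginal_one :
    seqEntropy (marginal r H w) 1 = ∑ v, negMulLog (marginal r H w {v}) := by
  simp [seqEntropy, powersetCard_one]

/-- A full ordering determines its edge, and given the edge it is uniform among `r!` orderings. -/
theorem seqEntropy_marginal_top (hH : (H : Set (Finset V)).Sized r) (h1 : ∑ e ∈ H, w e = 1) :
    seqEntropy (marginal r H w) r = (∑ e ∈ H, negMulLog (w e)) + log r.factorial := by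
  have hf : (r.factorial : ℝ) ≠ 0 := by positivity
  have hsub : H ⊆ powersetCard r univ := fun e he => mem_powersetCard.2 ⟨subset_univ _, hH he⟩
  rw [seqEntropy, ← Finset.sum_subset hsub fun T hT hTH => by
    rw [marginal_of_notMem hH (mem_powersetCard.1 hT).2 hTH, negMulLog_zero]]
  have : ∀ e ∈ H, negMulLog (marginal r H w e) =
      (r.factorial : ℝ)⁻¹ * negMulLog (w e) + w e * ((r.factorial : ℝ)⁻¹ * log r.factorial) := by
    intro e he
    rw [marginal_of_mem hH he, div_eq_mul_inv, negMulLog_mul, negMulLog, negMulLog, log_inv]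
    ring
  rw [Finset.sum_congr rfl this, Finset.sum_add_distrib, ← Finset.mul_sum, ← Finset.sum_mul, h1]
  field_simp

/-- Drawing an edge `e` with probability proportional to `∏ v ∈ e, y v` bounds the Lagrangian in terms of
entropy. -/
theorem log_sum_prod_le (hH : (H : Set (Finset V)).Sized r) (hr : 1 ≤ r) {y : V → ℝ}
    (hy : ∀ v, 0 ≤ y v) (hy1 : ∑ v, y v = 1) (hpos : 0 < ∑ e ∈ H, ∏ v ∈ e, y v)
    (hw : ∀ e, w e = (∏ v ∈ e, y v) / ∑ e ∈ H, ∏ v ∈ e, y v) :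
    log (∑ e ∈ H, ∏ v ∈ e, y v) + log r.factorial ≤
      seqEntropy (marginal r H w) r - r * seqEntropy (marginal r H w) 1 := by
  set Λ := ∑ e ∈ H, ∏ v ∈ e, y v
  have hw0 : ∀ e ∈ H, 0 ≤ w e := fun e _ => by
    rw [hw]; exact div_nonneg (prod_nonneg fun v _ => hy v) hpos.le
  have hw1 : ∑ e ∈ H, w e = 1 := by
    rw [Finset.sum_congr rfl fun e _ => hw e, ← Finset.sum_div, div_self hpos.ne']
  have hmz : ∀ v, y v = 0 → marginal r H w {v} = 0 := by
    intro v hv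
    rw [marginal_singleton hr, Finset.sum_eq_zero, zero_div]
    intro e he
    rw [hw, prod_eq_zero (mem_filter.1 he).2 hv, zero_div]
  have hm1 : ∑ v, marginal r H w {v} = 1 := by
    have := sum_marginal_insert (w := w) hH (T := ∅) (by rw [card_empty]; omega)
    rw [marginal_empty, hw1] at this
    simpa using this
  -- The entropy of the first vertex is at most its cross entropy against `y`, which is also what
  -- `log (w e)` produces below.
  have hG := sum_negMulLog_le univ (fun v => marginal r H w {v}) y
    (fun v _ => marginal_nonneg hw0 _) (fun v _ => hy v) (fun v _ => hmz v) (by rw [hy1, hm1])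
  have hE : ∑ e ∈ H, negMulLog (w e) = log Λ - ∑ e ∈ H, w e * ∑ v ∈ e, log (y v) := by
    have : ∀ e ∈ H, negMulLog (w e) = w e * log Λ - w e * ∑ v ∈ e, log (y v) := by
      intro e _
      by_cases h0 : ∏ v ∈ e, y v = 0
      · simp [hw e, h0]
      · have hl : log (w e) = (∑ v ∈ e, log (y v)) - log Λ := by
          rw [hw, log_div h0 hpos.ne', log_prod fun v hv hv0 => h0 (prod_eq_zero hv hv0)]
        rw [negMulLog, hl]
        ring
    rw [Finset.sum_congr rfl this, Finset.sum_sub_distrib, ← Finset.sum_mul, hw1, one_mul]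
  rw [seqEntropy_marginal_top hH hw1, seqEntropy_marginal_one, hE,
    ← sum_marginal_singleton_mul hr]
  have := mul_le_mul_of_nonneg_left hG (Nat.cast_nonneg (α := ℝ) r)
  linarith

end UniformHypergraph

/-! ### The binomial polynomial and sequences dropping by at least one. -/

namespace UniformHypergraph

theorem prod_sub_eq_of_ringChoose {r m : ℕ} {s : ℝ} (hms : (m : ℝ) = Ring.choose s r) :
    ∏ i ∈ range r, (s - i) = r.factorial * m := by
  have : (r.factorial : ℝ) ≠ 0 := by positivity
  rw [hms, Real.ringChoose_eq_prod_div]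
  field_simp

theorem lt_of_ringChoose_pos {r m : ℕ} {s : ℝ} (hr : 2 ≤ r) (hm : 0 < m) (hs : (r : ℝ) - 1 ≤ s)
    (hms : (m : ℝ) = Ring.choose s r) : (r : ℝ) - 1 < s := by
  refine hs.lt_of_ne fun h => ?_
  have h1 := prod_sub_eq_of_ringChoose hms
  rw [prod_eq_zero (i := r - 1) (mem_range.2 (by omega))] at h1
  · have : (0 : ℝ) < r.factorial * m := by positivity
    linarith
  · rw [← h, Nat.cast_sub (by omega)]
    simp

theorem eq_of_ringChoose_eq_zero {r : ℕ} {s : ℝ} (hs : (r : ℝ) - 1 ≤ s)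
    (h0 : Ring.choose s r = 0) : s = (r : ℝ) - 1 := by
  by_contra hne
  have hlt : (r : ℝ) - 1 < s := hs.lt_of_ne (Ne.symm hne)
  have h1 := prod_sub_eq_of_ringChoose (m := 0) (by simpa using h0.symm)
  have : 0 < ∏ i ∈ range r, (s - i) := by
    refine prod_pos fun i hi => ?_
    have : ((i + 1 : ℕ) : ℝ) ≤ r := by exact_mod_cast mem_range.1 hi
    push_cast at this
    linarith
  simp at h1
  linarith

section Descent

variable {r : ℕ} {u : ℕ → ℝ}

theorem le_sub_of_descent (hu : ∀ i, i + 1 < r → u (i + 1) + 1 ≤ u i) (i : ℕ) (hi : i + 1 < r) :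
    u (i + 1) ≤ u 1 - i := by
  induction i with
  | zero => simp
  | succ i ih =>
    have := ih (by omega)
    have := hu (i + 1) hi
    push_cast
    linarith

theorem le_sub_of_descent_zero (hu : ∀ i, i + 1 < r → u (i + 1) + 1 ≤ u i) (i : ℕ) (hi : i < r) :
    u i ≤ u 0 - i := by
  cases i with
  | zero => simp
  | succ i =>
    have := le_sub_of_descent hu i hi
    have := hu 0 (by omega)
    push_cast
    simp at this
    linarith

/-- Factor by factor, `u i / u 0 ≤ 1 - i / u 0 ≤ 1 - i / s`, and the second inequality is strict at
`i = 1`. -/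
theorem prod_descent_lt (hr : 2 ≤ r) (hu0 : ∀ i, 0 < u i)
    (hu : ∀ i, i + 1 < r → u (i + 1) + 1 ≤ u i) {s : ℝ} (h : u 0 < s) :
    (∏ i ∈ range r, u i) * s ^ r < (∏ i ∈ range r, (s - i)) * u 0 ^ r := by
  have hs : 0 < s := (hu0 0).trans h
  have key : ∏ i ∈ range r, (u i * s) < ∏ i ∈ range r, ((s - i) * u 0) := by
    have hle : ∀ i ∈ range r, u i * s + i * (s - u 0) ≤ (s - i) * u 0 := fun i hi => by
      have := mul_le_mul_of_nonneg_right (le_sub_of_descent_zero hu i (mem_range.1 hi)) hs.le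
      linarith
    refine prod_lt_prod (fun i _ => mul_pos (hu0 i) hs) (fun i hi => ?_)
      ⟨1, mem_range.2 (by omega), ?_⟩
    · have := hle i hi
      have : 0 ≤ (i : ℝ) * (s - u 0) := mul_nonneg (Nat.cast_nonneg i) (sub_nonneg.2 h.le)
      linarith
    · have := hle 1 (mem_range.2 (by omega))
      push_cast at this ⊢
      linarith
  simpa [prod_mul_distrib] using key

/-- Each `u i` is at most `u 0 - i`, so a strict drop at `i = 1` would make the product too small.
-/
theorem eq_sub_one_of_prod_descent (hr : 2 ≤ r) (hu0 : ∀ i, 0 < u i)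
    (hu : ∀ i, i + 1 < r → u (i + 1) + 1 ≤ u i)
    (h : ∏ i ∈ range r, (u 0 - i) ≤ ∏ i ∈ range r, u i) : u 1 = u 0 - 1 := by
  by_contra hne
  have hlt : u 1 < u 0 - 1 := by
    refine lt_of_le_of_ne ?_ hne
    have := hu 0 (by omega)
    simp at this
    linarith
  refine absurd h (not_le.2 (prod_lt_prod (fun i _ => hu0 i)
    (fun i hi => le_sub_of_descent_zero hu i (mem_range.1 hi))
    ⟨1, mem_range.2 (by omega), by simpa using hlt⟩))

end Descent

/-! ### The Lagrangian bound and the passage to exponent `p`. -/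

variable {V : Type*} [Fintype V]

/-- The smooth Frankl–Füredi bound on the Lagrangian of a hypergraph with `m = s.choose r` edges,
with the case of equality. -/
theorem sum_prod_le_of_ringChoose {r : ℕ} (hr : 2 ≤ r) {H : Finset (Finset V)}
    (hH : (H : Set (Finset V)).Sized r) {m : ℕ} (hm : H.card = m) (hm0 : 0 < m) {s : ℝ}
    (hs : (r : ℝ) - 1 ≤ s) (hms : (m : ℝ) = Ring.choose s r) {y : V → ℝ} (hy : ∀ v, 0 ≤ y v)
    (hy1 : ∑ v, y v = 1) :
    ∑ e ∈ H, ∏ v ∈ e, y v ≤ m / s ^ r ∧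
      (∑ e ∈ H, ∏ v ∈ e, y v = m / s ^ r → ∃ n : ℕ, s = n ∧ IsCompleteWithIsolated r H n) := by
  classical
  have hr2 : (2 : ℝ) ≤ r := by exact_mod_cast hr
  have hsr := lt_of_ringChoose_pos hr hm0 hs hms
  have hs1 : 1 < s := by linarith
  have hs0 : 0 < s := by linarith
  have hmpos : (0 : ℝ) < m := by exact_mod_cast hm0
  have hspow : 0 < s ^ r := pow_pos hs0 r
  have hrf : (0 : ℝ) < r.factorial := by positivity
  have hprod := prod_sub_eq_of_ringChoose hms
  rcases (Finset.sum_nonneg fun e _ => prod_nonneg fun v _ => hy v :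
    0 ≤ ∑ e ∈ H, ∏ v ∈ e, y v).eq_or_lt with h0 | hpos
  · rw [← h0]
    have : 0 < m / s ^ r := by positivity
    exact ⟨this.le, fun h => absurd h this.ne⟩
  set w : Finset V → ℝ := fun e => (∏ v ∈ e, y v) / ∑ e ∈ H, ∏ v ∈ e, y v with hw
  have hlog := log_sum_prod_le hH (by omega) hy hy1 hpos (w := w) (fun _ => rfl)
  set Λ := ∑ e ∈ H, ∏ v ∈ e, y v
  have hw0 : ∀ e ∈ H, 0 ≤ w e := fun e _ => div_nonneg (prod_nonneg fun v _ => hy v) hpos.le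
  have hw1 : ∑ e ∈ H, w e = 1 := by rw [hw, ← Finset.sum_div, div_self hpos.ne']
  set P := marginal r H w with hPdef
  have hP0 : ∀ T, 0 ≤ P T := marginal_nonneg hw0
  have hP : ∀ T, T.card < r → ∑ v ∈ Tᶜ, P (insert v T) = P T := fun T hT =>
    sum_marginal_insert hH hT
  have hPe : P ∅ = 1 := marginal_empty.trans hw1
  have hE0 : seqEntropy P 0 = 0 := seqEntropy_marginal_zero hw1
  set u : ℕ → ℝ := fun i => exp (seqEntropy P (i + 1) - seqEntropy P i) with hu_def
  have hu0 : ∀ i, 0 < u i := fun i => exp_pos _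
  have hu : ∀ i, i + 1 < r → u (i + 1) + 1 ≤ u i := fun i hi =>
    exp_seqEntropy_gap hP0 hP hPe i (by omega)
  have hprodu : ∏ i ∈ range r, u i = exp (seqEntropy P r) := by
    rw [hu_def, ← exp_sum, Finset.sum_range_sub, hE0, sub_zero]
  have hu0eq : u 0 = exp (seqEntropy P 1) := by simp [hu_def, hE0]
  have hup : 0 < u 0 ^ r := pow_pos (hu0 0) r
  -- Counting only edges of positive weight matters for equality, where `m' = m` shows that no edge
  -- has weight zero.
  set m' := (H.filter fun e => w e ≠ 0).card with hm'
  have hm'm : m' ≤ m := hm ▸ card_filter_le _ _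
  have hA : Λ * r.factorial * u 0 ^ r ≤ ∏ i ∈ range r, u i := by
    rw [hprodu, ← log_le_iff_le_exp (by positivity), log_mul (by positivity) hup.ne',
      log_mul hpos.ne' hrf.ne', log_pow, hu0eq, log_exp]
    linarith
  have hm'0 : (0 : ℝ) < m' := by
    have : (H.filter fun e => w e ≠ 0).Nonempty := by
      by_contra h
      rw [not_nonempty_iff_eq_empty, filter_eq_empty_iff] at h
      have : ∑ e ∈ H, w e = 0 := Finset.sum_eq_zero fun e he => by simpa using h he
      linarith
    exact_mod_cast this.card_pos
  have hB : ∏ i ∈ range r, u i ≤ r.factorial * m' := by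
    rw [hprodu, ← le_log_iff_exp_le (by positivity), log_mul hrf.ne' hm'0.ne', hPdef,
      seqEntropy_marginal_top hH hw1]
    have := sum_negMulLog_le_log_card hw0 hw1
    linarith
  have hBm : ∏ i ∈ range r, u i ≤ r.factorial * m :=
    hB.trans (mul_le_mul_of_nonneg_left (by exact_mod_cast hm'm) hrf.le)
  rcases lt_trichotomy (u 0) s with hlt | heq | hgt
  · have h1 := prod_descent_lt hr hu0 hu hlt
    rw [hprod] at h1
    have h2 := mul_le_mul_of_nonneg_right hA hspow.le
    have h3 : (r.factorial * u 0 ^ r) * (Λ * s ^ r) < (r.factorial * u 0 ^ r) * m := by linarith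
    have h4 : Λ < m / s ^ r := by
      rw [lt_div_iff₀ hspow]
      exact lt_of_mul_lt_mul_left h3 (by positivity)
    exact ⟨h4.le, fun h => absurd h h4.ne⟩
  · rw [heq] at hA
    refine ⟨?_, fun h => ?_⟩
    · rw [le_div_iff₀ hspow]
      refine le_of_mul_le_mul_left ?_ hrf
      linarith
    rw [h, show m / s ^ r * r.factorial * s ^ r = r.factorial * m by field_simp] at hA
    have hmm' : m' = m := by
      refine le_antisymm hm'm ?_
      have := le_of_mul_le_mul_left (hA.trans hB) hrf
      exact_mod_cast this
    have hu1 : u 1 = u 0 - 1 := eq_sub_one_of_prod_descent hr hu0 hu (by rwa [heq, hprod])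
    have hs1' : 0 < s - 1 := by linarith
    have hD1 : seqEntropy P 1 - seqEntropy P 0 = log s := by rw [← heq, hu_def, log_exp]
    have hD2 : seqEntropy P 2 - seqEntropy P 1 = log (s - 1) := by
      rw [← heq, ← hu1, hu_def, log_exp]
    -- With `u 1 = s - 1` the optimal mixing parameter `1 / (u 1 + 1)` is `1 / s`, and the first gap
    -- inequality is tight.
    have hPs : ∀ v, P {v} ≠ 0 → P {v} = 1 / s := by
      refine singleton_eq_of_seqEntropy_eq hP0 hP hPe hr (by positivity)
        (by rw [div_le_one hs0]; exact hs1.le) ?_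
      have hq : 1 - 1 / s = (s - 1) / s := by field_simp
      rw [hD1, hD2, hq, negMulLog, negMulLog, log_div one_ne_zero hs0.ne',
        log_div hs1'.ne' hs0.ne', log_one]
      field_simp
      ring
    set S := univ.filter fun v => P {v} ≠ 0 with hS
    have hsum : ∑ v, P {v} = 1 := by
      have := hP ∅ (by rw [card_empty]; omega)
      rw [hPe] at this
      simpa using this
    have hSs : s = S.card := by
      rw [← sum_filter_ne_zero, ← hS, Finset.sum_congr rfl fun v hv => hPs v (mem_filter.1 hv).2,
        sum_const, nsmul_eq_mul] at hsum
      field_simp at hsum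
      linarith
    refine ⟨S.card, hSs, S, rfl, ?_⟩
    have hall : ∀ e ∈ H, w e ≠ 0 := card_filter_eq_iff.1 (hmm'.trans hm.symm)
    -- Every edge has positive weight, so it lies in `S`; and `m` is exactly the number of
    -- `r`-subsets of `S`.
    refine eq_of_subset_of_card_le (fun e he => mem_powersetCard.2 ⟨fun v hv => ?_, hH he⟩) ?_
    · rw [hS, mem_filter, hPdef, marginal_singleton (by omega)]
      refine ⟨mem_univ _, (div_pos ?_ (by positivity)).ne'⟩
      refine lt_of_lt_of_le ((hw0 e he).lt_of_ne (hall e he).symm) ?_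
      exact single_le_sum (fun e he => hw0 e (mem_filter.1 he).1) (mem_filter.2 ⟨he, hv⟩)
    · rw [card_powersetCard, hm]
      rw [hSs, Ring.choose_natCast] at hms
      exact le_of_eq (by exact_mod_cast hms.symm)
  · have h1 : Λ < m / s ^ r := by
      rw [lt_div_iff₀ hspow]
      have h2 : Λ * s ^ r < Λ * u 0 ^ r :=
        mul_lt_mul_of_pos_left (pow_lt_pow_left₀ hgt hs0.le (by omega)) hpos
      refine h2.trans_le (le_of_mul_le_mul_left ?_ hrf)
      linarith
    exact ⟨h1.le, fun h => absurd h h1.ne⟩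

theorem pNorm_eq_one_iff {p : ℝ} (hp : 0 < p) {x : V → ℝ} :
    pNorm p x = 1 ↔ ∑ i, |x i| ^ p = 1 := by
  have hsum0 : 0 ≤ ∑ i, |x i| ^ p := Finset.sum_nonneg fun i _ => by positivity
  rw [pNorm, one_div, Real.rpow_inv_eq hsum0 zero_le_one hp.ne', Real.one_rpow]

/-- Reduction of the bound for exponent `p` to exponent `1`. -/
theorem polyForm_le_of_ringChoose {r : ℕ} (hr : 2 ≤ r) {p : ℝ} (hp : 1 ≤ p) {H : Finset (Finset V)}
    (hH : (H : Set (Finset V)).Sized r) {m : ℕ} (hm : H.card = m) (hm0 : 0 < m) {s : ℝ}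
    (hs : (r : ℝ) - 1 ≤ s) (hms : (m : ℝ) = Ring.choose s r) {x : V → ℝ}
    (hx : x ∈ nonnegSphere V p) :
    polyForm r H x ≤ r * m / s ^ ((r : ℝ) / p) ∧
      (polyForm r H x = r * m / s ^ ((r : ℝ) / p) →
        ∃ n : ℕ, s = n ∧ IsCompleteWithIsolated r H n) := by
  obtain ⟨hx0, hx1⟩ := hx
  have hp0 : 0 < p := by linarith
  have hr2 : (2 : ℝ) ≤ r := by exact_mod_cast hr
  have hs0 : 0 < s := by linarith
  have hmpos : (0 : ℝ) < m := by exact_mod_cast hm0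
  rw [pNorm_eq_one_iff hp0] at hx1
  simp only [abs_of_nonneg (hx0 _)] at hx1
  obtain ⟨hle, heq⟩ := sum_prod_le_of_ringChoose hr hH hm hm0 hs hms
    (y := fun v => x v ^ p) (fun v => rpow_nonneg (hx0 v) p) hx1
  have hΛ0 : 0 ≤ ∑ e ∈ H, ∏ v ∈ e, x v :=
    Finset.sum_nonneg fun e _ => prod_nonneg fun v _ => hx0 v
  have hpm : (∑ e ∈ H, ∏ v ∈ e, x v) ^ p ≤ m ^ (p - 1) * ∑ e ∈ H, ∏ v ∈ e, x v ^ p := by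
    have := Real.rpow_sum_le_const_mul_sum_rpow_of_nonneg H hp
      (f := fun e => ∏ v ∈ e, x v) fun e _ => prod_nonneg fun v _ => hx0 v
    rw [hm] at this
    simpa only [Real.finsetProd_rpow _ _ (fun v _ => hx0 v)] using this
  have hmp : (0 : ℝ) < m ^ (p - 1) := rpow_pos_of_pos hmpos _
  have hsp : 0 < s ^ ((r : ℝ) / p) := rpow_pos_of_pos hs0 _
  have hrhs : (m / s ^ ((r : ℝ) / p)) ^ p = m ^ (p - 1) * (m / s ^ r) := by
    rw [div_rpow hmpos.le hsp.le, ← rpow_mul hs0.le, div_mul_cancel₀ _ hp0.ne', rpow_natCast,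
      rpow_sub_one hmpos.ne']
    field_simp
  have hr0 : (0 : ℝ) < r := by linarith
  rw [polyForm, mul_div_assoc]
  refine ⟨mul_le_mul_of_nonneg_left ?_ hr0.le, fun h => heq (le_antisymm hle ?_)⟩
  · rw [← rpow_le_rpow_iff hΛ0 (by positivity) hp0, hrhs]
    exact hpm.trans (mul_le_mul_of_nonneg_left hle hmp.le)
  -- Equality for `x` forces the Lagrangian of `x ^ p` to reach its own bound.
  · rw [mul_left_cancel₀ hr0.ne' h, hrhs] at hpm
    exact le_of_mul_le_mul_left hpm hmp

/-- The uniform vector on `S` attains the bound on the complete hypergraph on `S`. -/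
theorem exists_polyForm_powersetCard_eq {r : ℕ} {p : ℝ} (hp : 0 < p) {S : Finset V}
    (hS : S.Nonempty) :
    ∃ x ∈ nonnegSphere V p, polyForm r (S.powersetCard r) x =
      r * (S.powersetCard r).card / (S.card : ℝ) ^ ((r : ℝ) / p) := by
  classical
  have hc : (0 : ℝ) < S.card := by exact_mod_cast hS.card_pos
  -- Chosen so that `t ^ p = 1 / S.card`.
  set t : ℝ := (S.card : ℝ) ^ (-(1 / p)) with ht
  have ht0 : 0 ≤ t := rpow_nonneg hc.le _
  refine ⟨fun v => if v ∈ S then t else 0, ⟨fun v => ?_, ?_⟩, ?_⟩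
  · dsimp only
    split_ifs
    exacts [ht0, le_rfl]
  · rw [pNorm_eq_one_iff hp]
    have : ∀ v ∈ (univ : Finset V), |if v ∈ S then t else 0| ^ p =
        if v ∈ S then (S.card : ℝ)⁻¹ else 0 := by
      intro v _
      split_ifs
      · rw [abs_of_nonneg ht0, ht, ← rpow_mul hc.le, neg_mul, one_div, inv_mul_cancel₀ hp.ne',
          rpow_neg_one]
      · rw [abs_zero, zero_rpow hp.ne']
    rw [Finset.sum_congr rfl this, ← sum_filter]
    simp [hc.ne']
  · have h1 : ∀ e ∈ S.powersetCard r, ∏ v ∈ e, (if v ∈ S then t else 0) = t ^ r := by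
      intro e he
      obtain ⟨heS, her⟩ := mem_powersetCard.1 he
      rw [prod_congr rfl fun v hv => if_pos (heS hv), prod_const, her]
    rw [polyForm, Finset.sum_congr rfl h1, sum_const, nsmul_eq_mul, ht, ← rpow_natCast,
      ← rpow_mul hc.le, neg_mul, one_div_mul_eq_div, rpow_neg hc.le]
    ring

end UniformHypergraph

theorem theorem2 {V : Type*} [Fintype V] [Nonempty V]
    (r : ℕ) (hr : 2 ≤ r) (p : ℝ) (hp : 1 ≤ p)
    (H : Finset (Finset V)) (hH : (H : Set (Finset V)).Sized r)
    (m : ℕ) (hm : H.card = m)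
    (s : ℝ) (hs : (r : ℝ) - 1 ≤ s) (hms : (m : ℝ) = Ring.choose s r) :
    UniformHypergraph.pSpectralRadius p r H ≤ (r : ℝ) * m / s ^ ((r : ℝ) / p) ∧
    -- an edgeless hypergraph is `K_{r-1}^r` with isolated vertices if it has `r - 1` vertices
    (r ≤ Fintype.card V + 1 →
      (UniformHypergraph.pSpectralRadius p r H = (r : ℝ) * m / s ^ ((r : ℝ) / p) ↔
        ∃ n : ℕ, s = n ∧ UniformHypergraph.IsCompleteWithIsolated r H n)) := by
  obtain ⟨⟨x, hx, hxρ⟩, hmax⟩ := UniformHypergraph.isGreatest_pSpectralRadius hp r H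
  rcases Nat.eq_zero_or_pos m with rfl | hm0
  · obtain rfl := Finset.card_eq_zero.1 hm
    have hρ : UniformHypergraph.pSpectralRadius p r (∅ : Finset (Finset V)) = 0 := by
      rw [← hxρ]
      simp [UniformHypergraph.polyForm]
    rw [hρ]
    -- Without edges `s = r - 1`, and any set of `r - 1` vertices has no `r`-subsets.
    refine ⟨by simp, fun hV => ⟨fun _ => ⟨r - 1, ?_, ?_⟩, fun _ => by simp⟩⟩
    · rw [UniformHypergraph.eq_of_ringChoose_eq_zero hs (by simpa using hms.symm),
        Nat.cast_sub (by omega), Nat.cast_one]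
    · obtain ⟨S, -, hS⟩ := Finset.exists_subset_card_eq (s := (Finset.univ : Finset V))
        (n := r - 1) (by rw [Finset.card_univ]; omega)
      exact ⟨S, hS, (Finset.powersetCard_eq_empty.2 (by omega)).symm⟩
  · obtain ⟨hle, heq⟩ := UniformHypergraph.polyForm_le_of_ringChoose hr hp hH hm hm0 hs hms hx
    rw [hxρ] at hle heq
    refine ⟨hle, fun _ => ⟨heq, ?_⟩⟩
    rintro ⟨n, rfl, S, rfl, rfl⟩
    refine le_antisymm hle ?_
    have hS : S.Nonempty := by
      have hr2 : (2 : ℝ) ≤ r := by exact_mod_cast hr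
      have : (0 : ℝ) < S.card := by linarith
      exact Finset.card_pos.1 (by exact_mod_cast this)
    obtain ⟨z, hz, hzρ⟩ := UniformHypergraph.exists_polyForm_powersetCard_eq (r := r)
      (lt_of_lt_of_le one_pos hp) hS
    rw [← hm, ← hzρ]
    exact hmax (Set.mem_image_of_mem _ hz)
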